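/- Let $\mathcal X_1,\mathcal X_2,\mathcal S,\mathcal Y_2,\mathcal Y_3$ be finite sets with $\mathcal X_1,\mathcal X_2$ non-empty, let $Q_S$ be a probability distribution on $\mathcal S$, and let $W_{Y_2,Y_3|X_1,X_2,S}$ be a family of conditional probability distributions from $\mathcal X_1\times\mathcal X_2\times\mathcal S$ to $\mathcal Y_2\times\mathcal Y_3$. In the state-dependent discrete memoryless relay channel with informed relay, the states $S_1,\dots,S_n$ are i.i.d. with distribution $Q_S$ and the channel is memoryless with transition law $W_{Y_2,Y_3|X_1,X_2,S}$. A code of block length $n$ with $M$ messages consists of a source encoder $\{1,\dots,M\}\to\mathcal X_1^n$ (which does not see the state), relay encoders $\mathcal S^n\times\mathcal Y_2^{i-1}\to\mathcal X_2$, $1\le i\le n$ (the relay knows the whole state sequence and its past outputs), and a decoder $\mathcal Y_3^n\to\{1,\dots,M\}$ (which does not see the state). A rate $R\ge 0$ is achievable if there are codes of block length $n$ with $\lceil 2^{nR}\rceil$ messages, $n\ge 0$, whose error probability, for a uniformly distributed message, tends to $0$; the capacity is the supremum of the achievable rates. Mutual informations are in bits. Suppose that the channel is physically degraded, i.e. $$W_{Y_2,Y_3|X_1,X_2,S}=W_{Y_2|X_1,X_2,S}\,W_{Y_3|Y_2,X_2,S}$$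 for some families of conditional probability distributions $W_{Y_2|X_1,X_2,S}$ and $W_{Y_3|Y_2,X_2,S}$. Then the capacity is at most $$R^{\mathrm{out}}_{\mathrm D}=\max\min\Big\{I(X_1;Y_2|S,X_2),\ I(X_1,X_2;Y_3|S)-I(X_1;S|Y_3)\Big\},$$ where the maximum, which is attained, is over all joint distributions of the form $$P_{S,X_1,X_2,Y_2,Y_3}=Q_S\,P_{X_1}\,P_{X_2|X_1,S}\,W_{Y_2|X_1,X_2,S}\,W_{Y_3|Y_2,X_2,S}.$$ Moreover, $R^{\mathrm{out}}_{\mathrm D}$ is equal to $$R^{\mathrm{out}}=\max\min\Big\{I(X_1;Y_2,Y_3|S,X_2),\ I(X_1,X_2;Y_3|S)-I(X_1;S|Y_3)\Big\},$$ where the maximum, also attained, is over all joint distributions of the form $Q_S\,P_{X_1}\,P_{X_2|X_1,S}\,W_{Y_2,Y_3|X_1,X_2,S}$. -/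

import Mathlib

open Filter Topology

noncomputable section

namespace RelayInfo

/-! ### Information measures of random variables on a finite probability space, in bits -/

open Classical in
/-- `P(A = a)` for a random variable `A` on the finite space `Ω` with probability mass function
`p`. -/
def prob {Ω α : Type*} [Fintype Ω] (p : Ω → ℝ) (A : Ω → α) (a : α) : ℝ :=
  ∑ ω, if A ω = a then p ω else 0

/-- The conditional mutual information `I(A; B | C)` in bits,
`∑ P(a,b,c) log₂ (P(a,b,c) P(c) / (P(a,c) P(b,c)))`.
A triple of probability zero contributes `0`; for every other triple the four probabilities are
positive. -/
def condMutualInfo {Ω α β γ : Type*} [Fintype Ω] [Fintype α] [Fintype β] [Fintype γ]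
    (p : Ω → ℝ) (A : Ω → α) (B : Ω → β) (C : Ω → γ) : ℝ :=
  ∑ a, ∑ b, ∑ c,
    prob p (fun ω => (A ω, B ω, C ω)) (a, b, c) *
      Real.logb 2
        (prob p (fun ω => (A ω, B ω, C ω)) (a, b, c) * prob p C c /
          (prob p (fun ω => (A ω, C ω)) (a, c) * prob p (fun ω => (B ω, C ω)) (b, c)))

/-! ### The state-dependent discrete memoryless relay channel -/

/-- A state-dependent discrete memoryless relay channel: a state distribution `Q` on `S` and a
family `W x₁ x₂ s` of probability distributions on `Y₂ × Y₃`, where `x₁` is the source input,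
`x₂` the relay input, `Y₂` the relay output alphabet and `Y₃` the destination output alphabet. -/
structure RelayChannel (X₁ X₂ S Y₂ Y₃ : Type*) [Fintype S] [Fintype Y₂] [Fintype Y₃] where
  Q : S → ℝ
  Q_mem : Q ∈ stdSimplex ℝ S
  W : X₁ → X₂ → S → Y₂ × Y₃ → ℝ
  W_mem : ∀ x₁ x₂ s, W x₁ x₂ s ∈ stdSimplex ℝ (Y₂ × Y₃)

/-- A code of block length `n` with `M` messages for the relay channel with informed relay. The
source maps the message to its input word. The relay input at time `i` depends on the whole state
sequence (noncausally) and on the relay outputs at the times before `i`. The destination decodes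
from its output word. -/
structure Code (X₁ X₂ S Y₂ Y₃ : Type*) (n M : ℕ) where
  enc : Fin M → Fin n → X₁
  relay : (i : Fin n) → (Fin n → S) → (Fin i → Y₂) → X₂
  dec : (Fin n → Y₃) → Fin M

section

variable {X₁ X₂ S Y₂ Y₃ : Type*} [Fintype X₁] [Fintype X₂] [Fintype S] [Fintype Y₂] [Fintype Y₃]

namespace RelayChannel

/-- The probability that the states are `s` and the outputs are `y₂`, `y₃`, given that message `m`
is sent: the states are i.i.d. with distribution `Q` and the channel is memoryless. -/
def law (ch : RelayChannel X₁ X₂ S Y₂ Y₃) {n M : ℕ} (c : Code X₁ X₂ S Y₂ Y₃ n M) (m : Fin M)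
    (s : Fin n → S) (y₂ : Fin n → Y₂) (y₃ : Fin n → Y₃) : ℝ :=
  ∏ i : Fin n, ch.Q (s i) *
    ch.W (c.enc m i) (c.relay i s fun j => y₂ (Fin.castLE i.isLt.le j)) (s i) (y₂ i, y₃ i)

/-- The probability of a decoding error, for a uniformly distributed message. -/
def errorProb (ch : RelayChannel X₁ X₂ S Y₂ Y₃) {n M : ℕ} (c : Code X₁ X₂ S Y₂ Y₃ n M) : ℝ :=
  (∑ m : Fin M, ∑ s : Fin n → S, ∑ y₂ : Fin n → Y₂, ∑ y₃ : Fin n → Y₃,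
    if c.dec y₃ = m then 0 else ch.law c m s y₂ y₃) / M

/-- The rate `R ≥ 0` (in bits per channel use) is achievable: there are codes with `⌈2 ^ (n R)⌉`
messages, one for every block length `n`, whose error probability tends to `0`. -/
def Achievable (ch : RelayChannel X₁ X₂ S Y₂ Y₃) (R : ℝ) : Prop :=
  0 ≤ R ∧ ∃ c : (n : ℕ) → Code X₁ X₂ S Y₂ Y₃ n ⌈(2 : ℝ) ^ ((n : ℝ) * R)⌉₊,
    Tendsto (fun n => ch.errorProb (c n)) atTop (𝓝 0)

/-- The capacity: the supremum of the achievable rates, taken in the extended reals. -/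
def capacity (ch : RelayChannel X₁ X₂ S Y₂ Y₃) : EReal :=
  sSup {r : EReal | ∃ R : ℝ, ch.Achievable R ∧ r = R}

/-- The channel is physically degraded, with factors `W₂ = W_{Y₂|X₁,X₂,S}` and
`W₃ = W_{Y₃|Y₂,X₂,S}`, which are families of probability distributions. -/
structure IsDegradedVia (ch : RelayChannel X₁ X₂ S Y₂ Y₃)
    (W₂ : X₁ → X₂ → S → Y₂ → ℝ) (W₃ : Y₂ → X₂ → S → Y₃ → ℝ) : Prop where
  left_mem : ∀ x₁ x₂ s, W₂ x₁ x₂ s ∈ stdSimplex ℝ Y₂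
  right_mem : ∀ y₂ x₂ s, W₃ y₂ x₂ s ∈ stdSimplex ℝ Y₃
  factor : ∀ x₁ x₂ s y₂ y₃, ch.W x₁ x₂ s (y₂, y₃) = W₂ x₁ x₂ s y₂ * W₃ y₂ x₂ s y₃

end RelayChannel

/-! ### Single-letter bounds

The sample space is `S × X₁ × X₂ × Y₂ × Y₃`; its coordinates are the random variables. -/

/-- The joint distribution `Q_S P_{X₁} P_{X₂|X₁,S} W_{Y₂,Y₃|X₁,X₂,S}`. -/
def joint (Q : S → ℝ) (P₁ : X₁ → ℝ) (P₂ : X₁ → S → X₂ → ℝ) (W : X₁ → X₂ → S → Y₂ × Y₃ → ℝ) :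
    S × X₁ × X₂ × Y₂ × Y₃ → ℝ :=
  fun (s, x₁, x₂, y₂, y₃) => Q s * P₁ x₁ * P₂ x₁ s x₂ * W x₁ x₂ s (y₂, y₃)

/-- The joint distribution `Q_S P_{X₁} P_{X₂|X₁,S} W_{Y₂|X₁,X₂,S} W_{Y₃|Y₂,X₂,S}`. -/
def jointDegraded (Q : S → ℝ) (P₁ : X₁ → ℝ) (P₂ : X₁ → S → X₂ → ℝ)
    (W₂ : X₁ → X₂ → S → Y₂ → ℝ) (W₃ : Y₂ → X₂ → S → Y₃ → ℝ) : S × X₁ × X₂ × Y₂ × Y₃ → ℝ :=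
  fun (s, x₁, x₂, y₂, y₃) => Q s * P₁ x₁ * P₂ x₁ s x₂ * W₂ x₁ x₂ s y₂ * W₃ y₂ x₂ s y₃

/-- `min {I(X₁; Y₂, Y₃ | S, X₂), I(X₁, X₂; Y₃ | S) - I(X₁; S | Y₃)}`. -/
def generalRate (p : S × X₁ × X₂ × Y₂ × Y₃ → ℝ) : ℝ :=
  min
    (condMutualInfo p (fun (_, x₁, _, _, _) => x₁) (fun (_, _, _, y₂, y₃) => (y₂, y₃))
      (fun (s, _, x₂, _, _) => (s, x₂)))
    (condMutualInfo p (fun (_, x₁, x₂, _, _) => (x₁, x₂)) (fun (_, _, _, _, y₃) => y₃)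
        (fun (s, _, _, _, _) => s) -
      condMutualInfo p (fun (_, x₁, _, _, _) => x₁) (fun (s, _, _, _, _) => s)
        (fun (_, _, _, _, y₃) => y₃))

/-- `min {I(X₁; Y₂ | S, X₂), I(X₁, X₂; Y₃ | S) - I(X₁; S | Y₃)}`. -/
def degradedRate (p : S × X₁ × X₂ × Y₂ × Y₃ → ℝ) : ℝ :=
  min
    (condMutualInfo p (fun (_, x₁, _, _, _) => x₁) (fun (_, _, _, y₂, _) => y₂)
      (fun (s, _, x₂, _, _) => (s, x₂)))
    (condMutualInfo p (fun (_, x₁, x₂, _, _) => (x₁, x₂)) (fun (_, _, _, _, y₃) => y₃)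
        (fun (s, _, _, _, _) => s) -
      condMutualInfo p (fun (_, x₁, _, _, _) => x₁) (fun (s, _, _, _, _) => s)
        (fun (_, _, _, _, y₃) => y₃))

/-- The values over which the upper bound for a general channel is the maximum. -/
def generalValues (ch : RelayChannel X₁ X₂ S Y₂ Y₃) : Set ℝ :=
  {r | ∃ (P₁ : X₁ → ℝ) (P₂ : X₁ → S → X₂ → ℝ), P₁ ∈ stdSimplex ℝ X₁ ∧
    (∀ x₁ s, P₂ x₁ s ∈ stdSimplex ℝ X₂) ∧ r = generalRate (joint ch.Q P₁ P₂ ch.W)}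

/-- The values over which the upper bound for a degraded channel is the maximum. -/
def degradedValues (Q : S → ℝ) (W₂ : X₁ → X₂ → S → Y₂ → ℝ) (W₃ : Y₂ → X₂ → S → Y₃ → ℝ) : Set ℝ :=
  {r | ∃ (P₁ : X₁ → ℝ) (P₂ : X₁ → S → X₂ → ℝ), P₁ ∈ stdSimplex ℝ X₁ ∧
    (∀ x₁ s, P₂ x₁ s ∈ stdSimplex ℝ X₂) ∧ r = degradedRate (jointDegraded Q P₁ P₂ W₂ W₃)}

end

end RelayInfo

end

namespace RelayInfo

section Prob

variable {Ω α β γ δ : Type*} [Fintype Ω] [Fintype α] [Fintype β] [Fintype γ] {p : Ω → ℝ}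

theorem prob_nonneg (hp : ∀ ω, 0 ≤ p ω) (A : Ω → δ) (a : δ) : 0 ≤ prob p A a :=
  Finset.sum_nonneg fun ω _ => by split_ifs <;> simp [hp ω]

theorem le_prob (hp : ∀ ω, 0 ≤ p ω) (A : Ω → δ) (ω : Ω) : p ω ≤ prob p A (A ω) := by
  classical
  have h := Finset.single_le_sum (f := fun ω' => if A ω' = A ω then p ω' else 0)
    (fun ω' _ => by split_ifs <;> simp [hp ω']) (Finset.mem_univ ω)
  simpa [prob] using h

theorem prob_pos (hp : ∀ ω, 0 ≤ p ω) (A : Ω → δ) {ω : Ω} (h : 0 < p ω) : 0 < prob p A (A ω) :=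
  h.trans_le (le_prob hp A ω)

theorem prob_congr {ε : Type*} {A : Ω → δ} {B : Ω → ε} {a : δ} {b : ε}
    (h : ∀ ω, A ω = a ↔ B ω = b) : prob p A a = prob p B b := by
  classical
  unfold prob
  exact Finset.sum_congr rfl fun ω _ => if_congr (h ω) rfl rfl

theorem sum_prob_mul (p : Ω → ℝ) (A : Ω → α) (f : α → ℝ) :
    ∑ a, prob p A a * f a = ∑ ω, p ω * f (A ω) := by
  classical
  simp only [prob, Finset.sum_mul]
  rw [Finset.sum_comm]
  refine Finset.sum_congr rfl fun ω _ => ?_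
  simp [ite_mul]

theorem sum_prob (p : Ω → ℝ) (A : Ω → α) : ∑ a, prob p A a = ∑ ω, p ω := by
  simpa using sum_prob_mul p A fun _ => 1

theorem sum_prob_pair_left (p : Ω → ℝ) (A : Ω → α) (B : Ω → δ) (b : δ) :
    ∑ a, prob p (fun ω => (A ω, B ω)) (a, b) = prob p B b := by
  classical
  simp only [prob, Prod.mk.injEq]
  rw [Finset.sum_comm]
  refine Finset.sum_congr rfl fun ω _ => ?_
  by_cases h : B ω = b <;> simp [h]

theorem sum_prob_triple_middle {ε : Type*} (p : Ω → ℝ) (A : Ω → δ) (B : Ω → β) (C : Ω → ε)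
    (a : δ) (c : ε) :
    ∑ b, prob p (fun ω => (A ω, B ω, C ω)) (a, b, c) = prob p (fun ω => (A ω, C ω)) (a, c) := by
  classical
  simp only [prob, Prod.mk.injEq]
  rw [Finset.sum_comm]
  refine Finset.sum_congr rfl fun ω _ => ?_
  by_cases h : A ω = a <;> by_cases h' : C ω = c <;> simp [h, h']

/-- The probability of an event that is parametrized by an injective map. -/
theorem prob_eq_sum {κ : Type*} [Fintype κ] {A : Ω → δ} {a : δ} (e : κ → Ω)
    (he : Function.Injective e) (h : ∀ ω, A ω = a ↔ ∃ k, e k = ω) :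
    prob p A a = ∑ k, p (e k) := by
  classical
  have : Finset.univ.filter (fun ω => A ω = a) = Finset.univ.map ⟨e, he⟩ := by
    ext ω
    simp [h]
  rw [prob, ← Finset.sum_filter]
  convert Finset.sum_map Finset.univ ⟨e, he⟩ p
  rfl

theorem condMutualInfo_eq_sum (p : Ω → ℝ) (A : Ω → α) (B : Ω → β) (C : Ω → γ) :
    condMutualInfo p A B C = ∑ ω, p ω * Real.logb 2
      (prob p (fun ω => (A ω, B ω, C ω)) (A ω, B ω, C ω) * prob p C (C ω) /
        (prob p (fun ω => (A ω, C ω)) (A ω, C ω) * prob p (fun ω => (B ω, C ω)) (B ω, C ω))) := by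
  have h := sum_prob_mul p (fun ω => (A ω, B ω, C ω)) fun t => Real.logb 2
      (prob p (fun ω => (A ω, B ω, C ω)) t * prob p C t.2.2 /
        (prob p (fun ω => (A ω, C ω)) (t.1, t.2.2) *
          prob p (fun ω => (B ω, C ω)) t.2))
  rw [← h]
  simp only [condMutualInfo, Fintype.sum_prod_type]

/-- The Shannon entropy, in bits, of a random variable on a finite space. -/
noncomputable def entropy (p : Ω → ℝ) (A : Ω → α) : ℝ :=
  (∑ a, Real.negMulLog (prob p A a)) / Real.log 2

theorem entropy_eq_sum (p : Ω → ℝ) (A : Ω → α) :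
    entropy p A = -∑ ω, p ω * Real.logb 2 (prob p A (A ω)) := by
  rw [← sum_prob_mul p A fun a => Real.logb 2 (prob p A a), entropy, Finset.sum_div,
    ← Finset.sum_neg_distrib]
  refine Finset.sum_congr rfl fun a _ => ?_
  rw [Real.negMulLog, Real.logb]
  ring

theorem condMutualInfo_eq_entropy (hp : ∀ ω, 0 ≤ p ω) (A : Ω → α) (B : Ω → β) (C : Ω → γ) :
    condMutualInfo p A B C = entropy p (fun ω => (A ω, C ω)) + entropy p (fun ω => (B ω, C ω)) -
      entropy p (fun ω => (A ω, B ω, C ω)) - entropy p C := by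
  simp only [condMutualInfo_eq_sum, entropy_eq_sum, ← Finset.sum_neg_distrib,
    ← Finset.sum_add_distrib, ← Finset.sum_sub_distrib]
  refine Finset.sum_congr rfl fun ω _ => ?_
  rcases (hp ω).eq_or_lt with h | h
  · simp [← h]
  · have h1 := (prob_pos hp (fun ω => (A ω, B ω, C ω)) h).ne'
    have h2 := (prob_pos hp C h).ne'
    have h3 := (prob_pos hp (fun ω => (A ω, C ω)) h).ne'
    have h4 := (prob_pos hp (fun ω => (B ω, C ω)) h).ne'
    rw [Real.logb_div (mul_ne_zero h1 h2) (mul_ne_zero h3 h4), Real.logb_mul h1 h2,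
      Real.logb_mul h3 h4]
    ring

theorem continuous_entropy (A : Ω → α) : Continuous fun p : Ω → ℝ => entropy p A := by
  unfold entropy prob
  refine Continuous.div_const (continuous_finsetSum _ fun a _ => ?_) _
  refine Real.continuous_negMulLog.comp (continuous_finsetSum _ fun ω _ => ?_)
  split_ifs <;> fun_prop

theorem continuousOn_condMutualInfo (A : Ω → α) (B : Ω → β) (C : Ω → γ) :
    ContinuousOn (fun p : Ω → ℝ => condMutualInfo p A B C) {p | ∀ ω, 0 ≤ p ω} := by
  refine ContinuousOn.congr (Continuous.continuousOn ?_)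
    fun p hp => condMutualInfo_eq_entropy hp A B C
  exact (((continuous_entropy _).add (continuous_entropy _)).sub (continuous_entropy _)).sub
    (continuous_entropy _)

/-- **Gibbs' inequality**: the relative entropy with respect to a subprobability is nonnegative. -/
theorem sum_mul_logb_div_nonneg {r : Ω → ℝ} (hp : ∀ ω, 0 ≤ p ω) (hp1 : ∑ ω, p ω = 1)
    (hr : ∀ ω, 0 ≤ r ω) (hr1 : ∑ ω, r ω ≤ 1) (hpr : ∀ ω, 0 < p ω → 0 < r ω) :
    0 ≤ ∑ ω, p ω * Real.logb 2 (p ω / r ω) := by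
  have key : ∀ ω, p ω - r ω ≤ p ω * Real.log (p ω / r ω) := fun ω => by
    rcases (hp ω).eq_or_lt with h | h
    · simp [← h, hr ω]
    · have hr' := hpr ω h
      have h1 := Real.log_le_sub_one_of_pos (div_pos hr' h)
      have h2 : Real.log (p ω / r ω) = -Real.log (r ω / p ω) := by
        rw [← Real.log_inv, inv_div]
      have h3 : p ω * (r ω / p ω) = r ω := by field_simp
      rw [h2]
      nlinarith
  have h : 0 ≤ ∑ ω, p ω * Real.log (p ω / r ω) := by
    have := Finset.sum_le_sum fun ω (_ : ω ∈ Finset.univ) => key ω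
    rw [Finset.sum_sub_distrib] at this
    linarith
  have h2 : ∑ ω, p ω * Real.logb 2 (p ω / r ω) =
      (∑ ω, p ω * Real.log (p ω / r ω)) / Real.log 2 := by
    rw [Finset.sum_div]
    exact Finset.sum_congr rfl fun ω _ => by rw [Real.logb]; ring
  rw [h2]
  exact div_nonneg h (Real.log_nonneg (by norm_num))

end Prob

section Conditional

variable {β : Type*} [Fintype β]

/-- The probability distribution proportional to `f`; uniform if `f` has sum zero. -/
noncomputable def normalize (f : β → ℝ) (b : β) : ℝ :=
  if ∑ b', f b' = 0 then (Fintype.card β : ℝ)⁻¹ else f b / ∑ b', f b'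

theorem normalize_nonneg {f : β → ℝ} (hf : ∀ b, 0 ≤ f b) (b : β) : 0 ≤ normalize f b := by
  unfold normalize
  split_ifs
  · positivity
  · exact div_nonneg (hf b) (Finset.sum_nonneg fun b _ => hf b)

theorem sum_normalize [Nonempty β] (f : β → ℝ) : ∑ b, normalize f b = 1 := by
  unfold normalize
  split_ifs with h
  · simp
  · rw [← Finset.sum_div, div_self h]

theorem sum_mul_normalize {f : β → ℝ} (hf : ∀ b, 0 ≤ f b) (b : β) :
    (∑ b', f b') * normalize f b = f b := by
  unfold normalize
  split_ifs with h
  · rw [(Finset.sum_eq_zero_iff_of_nonneg fun b _ => hf b).1 h b (Finset.mem_univ b), h, zero_mul]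
  · field_simp

theorem normalize_eq_div {f : β → ℝ} (hf : ∀ b, 0 ≤ f b) {b : β} (hb : 0 < f b) :
    normalize f b = f b / ∑ b', f b' := by
  have : 0 < ∑ b', f b' := Finset.sum_pos' (fun b _ => hf b) ⟨b, Finset.mem_univ b, hb⟩
  rw [normalize, if_neg this.ne']

end Conditional

section Causal

variable {Y : Type*} [Fintype Y]

/-- A sequential product of (possibly signed) kernels of total mass one has total mass one. -/
theorem sum_prod_causal {n : ℕ} (K : (i : Fin n) → (Fin i → Y) → Y → ℝ)
    (hK : ∀ i h, ∑ y, K i h y = 1) :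
    ∑ y : Fin n → Y, ∏ i, K i (fun j => y (Fin.castLE i.isLt.le j)) (y i) = 1 := by
  induction n with
  | zero => simp
  | succ n ih =>
    rw [← (Fin.snocEquiv fun _ : Fin (n + 1) => Y).sum_comp, Fintype.sum_prod_type,
      Finset.sum_comm]
    rw [← ih (fun i => K i.castSucc) fun i h => hK i.castSucc h]
    refine Finset.sum_congr rfl fun y _ => ?_
    have key : ∀ y' : Y, ∏ i : Fin (n + 1), K i
        (fun j => (Fin.snocEquiv fun _ : Fin (n + 1) => Y) (y', y) (Fin.castLE i.isLt.le j))
          ((Fin.snocEquiv fun _ : Fin (n + 1) => Y) (y', y) i) =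
        (∏ i : Fin n, K i.castSucc (fun j => y (Fin.castLE i.isLt.le j)) (y i)) *
          K (Fin.last n) y y' := fun y' => by
      rw [Fin.prod_univ_castSucc]
      have hcast : ∀ i : Fin n, (Fin.snoc y y' : Fin (n + 1) → Y) i.castSucc = y i :=
        fun i => Fin.snoc_castSucc (α := fun _ => Y) y' y i
      congr 1
      · refine Finset.prod_congr rfl fun i _ => ?_
        simp only [Fin.snocEquiv_apply, hcast]
        congr 1
        funext j
        exact hcast (Fin.castLE i.isLt.le j)
      · simp only [Fin.snocEquiv_apply, Fin.snoc_last]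
        congr 1
        funext j
        exact hcast j
    simp only [key]
    rw [← Finset.mul_sum, hK, mul_one]
    rfl

/-- In a sequential product of kernels, a function of the past and the present may be averaged
over the present. -/
theorem sum_prod_causal_mul {n : ℕ} (K : (i : Fin n) → (Fin i → Y) → Y → ℝ)
    (hK : ∀ i h, ∑ y, K i h y = 1) (i : Fin n) (f : (Fin i → Y) → Y → ℝ) :
    ∑ y : Fin n → Y, (∏ j, K j (fun k => y (Fin.castLE j.isLt.le k)) (y j)) *
        f (fun k => y (Fin.castLE i.isLt.le k)) (y i) =
      ∑ y : Fin n → Y, (∏ j, K j (fun k => y (Fin.castLE j.isLt.le k)) (y j)) *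
        ∑ y', K i (fun k => y (Fin.castLE i.isLt.le k)) y' *
          f (fun k => y (Fin.castLE i.isLt.le k)) y' := by
  classical
  let d : (Fin i → Y) → Y → ℝ := fun h y => f h y - ∑ y', K i h y' * f h y' + 1
  let K' : (j : Fin n) → (Fin j → Y) → Y → ℝ := Function.update K i fun h y => K i h y * d h y
  have hK' : ∀ j h, ∑ y, K' j h y = 1 := fun j => by
    by_cases hj : j = i
    · subst hj
      intro h
      simp only [K', Function.update_self, d, mul_add, mul_sub, mul_one, Finset.sum_add_distrib,
        Finset.sum_sub_distrib, ← Finset.sum_mul, hK]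
      ring
    · intro h
      simp only [K', Function.update_of_ne hj, hK]
  have h1 := sum_prod_causal K' hK'
  have h0 := sum_prod_causal K hK
  have hprod : ∀ y : Fin n → Y,
      ∏ j, K' j (fun k => y (Fin.castLE j.isLt.le k)) (y j) =
        (∏ j, K j (fun k => y (Fin.castLE j.isLt.le k)) (y j)) *
          d (fun k => y (Fin.castLE i.isLt.le k)) (y i) := fun y => by
    rw [← Finset.mul_prod_erase _ _ (Finset.mem_univ i),
      ← Finset.mul_prod_erase Finset.univ
        (fun j => K j (fun k => y (Fin.castLE j.isLt.le k)) (y j)) (Finset.mem_univ i)]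
    have : ∏ j ∈ Finset.univ.erase i, K' j (fun k => y (Fin.castLE j.isLt.le k)) (y j) =
        ∏ j ∈ Finset.univ.erase i, K j (fun k => y (Fin.castLE j.isLt.le k)) (y j) :=
      Finset.prod_congr rfl fun j hj => by
        simp only [K', Function.update_of_ne (Finset.ne_of_mem_erase hj)]
    rw [this]
    simp only [K', Function.update_self]
    ring
  simp only [hprod, d, mul_add, mul_sub, mul_one, Finset.sum_add_distrib,
    Finset.sum_sub_distrib] at h1
  linarith

theorem sum_arrow_prod {ι A B : Type*} [Fintype ι] [DecidableEq ι] [Fintype A] [Fintype B]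
    (f : (ι → A) → (ι → B) → ℝ) :
    ∑ a, ∑ b, f a b = ∑ y : ι → A × B, f (fun i => (y i).1) (fun i => (y i).2) := by
  rw [← Fintype.sum_prod_type' f,
    ← (Equiv.arrowProdEquivProdArrow ι (fun _ => A) fun _ => B).sum_comp]
  rfl

end Causal

section SingleLetter

variable {X₁ X₂ S Y₂ Y₃ : Type*} [Fintype X₁] [Fintype X₂] [Fintype S] [Fintype Y₂] [Fintype Y₃]

theorem generalRate_eq (p : S × X₁ × X₂ × Y₂ × Y₃ → ℝ) :
    generalRate p = min
      (condMutualInfo p (fun z => z.2.1) (fun z => (z.2.2.2.1, z.2.2.2.2))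
        (fun z => (z.1, z.2.2.1)))
      (condMutualInfo p (fun z => (z.2.1, z.2.2.1)) (fun z => z.2.2.2.2) (fun z => z.1) -
        condMutualInfo p (fun z => z.2.1) (fun z => z.1) (fun z => z.2.2.2.2)) :=
  rfl

theorem degradedRate_eq (p : S × X₁ × X₂ × Y₂ × Y₃ → ℝ) :
    degradedRate p = min
      (condMutualInfo p (fun z => z.2.1) (fun z => z.2.2.2.1) (fun z => (z.1, z.2.2.1)))
      (condMutualInfo p (fun z => (z.2.1, z.2.2.1)) (fun z => z.2.2.2.2) (fun z => z.1) -
        condMutualInfo p (fun z => z.2.1) (fun z => z.1) (fun z => z.2.2.2.2)) :=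
  rfl

section Joint

variable {Q : S → ℝ} {P₁ : X₁ → ℝ} {P₂ : X₁ → S → X₂ → ℝ} {W : X₁ → X₂ → S → Y₂ × Y₃ → ℝ}

theorem joint_nonneg (hQ : Q ∈ stdSimplex ℝ S) (hP₁ : P₁ ∈ stdSimplex ℝ X₁)
    (hP₂ : ∀ x₁ s, P₂ x₁ s ∈ stdSimplex ℝ X₂) (hW : ∀ x₁ x₂ s, W x₁ x₂ s ∈ stdSimplex ℝ (Y₂ × Y₃))
    (z : S × X₁ × X₂ × Y₂ × Y₃) : 0 ≤ joint Q P₁ P₂ W z :=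
  mul_nonneg (mul_nonneg (mul_nonneg (hQ.1 _) (hP₁.1 _)) ((hP₂ _ _).1 _)) ((hW _ _ _).1 _)

theorem prob_joint_input_state (hW : ∀ x₁ x₂ s, W x₁ x₂ s ∈ stdSimplex ℝ (Y₂ × Y₃)) (x₁ : X₁)
    (x₂ : X₂) (s : S) :
    prob (joint Q P₁ P₂ W) (fun z => ((z.2.1, z.2.2.1), z.1)) ((x₁, x₂), s) =
      Q s * P₁ x₁ * P₂ x₁ s x₂ := by
  rw [prob_eq_sum (fun y : Y₂ × Y₃ => (s, x₁, x₂, y))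
    (fun y y' h => by simpa using h) (by rintro ⟨s', a, b, y⟩; simp; tauto)]
  have : ∀ y : Y₂ × Y₃, joint Q P₁ P₂ W (s, x₁, x₂, y) =
    Q s * P₁ x₁ * P₂ x₁ s x₂ * W x₁ x₂ s y := fun _ => rfl
  simp only [this]
  rw [← Finset.mul_sum, (hW x₁ x₂ s).2, mul_one]

theorem prob_joint_source_relay (hW : ∀ x₁ x₂ s, W x₁ x₂ s ∈ stdSimplex ℝ (Y₂ × Y₃)) (x₁ : X₁)
    (x₂ : X₂) (s : S) :
    prob (joint Q P₁ P₂ W) (fun z => (z.2.1, z.1, z.2.2.1)) (x₁, s, x₂) =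
      Q s * P₁ x₁ * P₂ x₁ s x₂ := by
  rw [← prob_joint_input_state hW]
  exact prob_congr fun z => by simp only [Prod.mk.injEq]; tauto

theorem prob_joint_letter (x₁ : X₁) (x₂ : X₂) (s : S) (y : Y₂ × Y₃) :
    prob (joint Q P₁ P₂ W)
        (fun z => (z.2.1, (z.2.2.2.1, z.2.2.2.2), z.1, z.2.2.1)) (x₁, y, s, x₂) =
      Q s * P₁ x₁ * P₂ x₁ s x₂ * W x₁ x₂ s y := by
  rw [prob_eq_sum (fun _ : Unit => (s, x₁, x₂, y))
    (fun y y' h => rfl) (by rintro ⟨s', a, b, y⟩; simp; tauto)]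
  simp [joint]

theorem prob_joint_input_output (x₁ : X₁) (x₂ : X₂) (s : S) (y₃ : Y₃) :
    prob (joint Q P₁ P₂ W)
        (fun z => ((z.2.1, z.2.2.1), z.2.2.2.2, z.1)) ((x₁, x₂), y₃, s) =
      Q s * P₁ x₁ * P₂ x₁ s x₂ * ∑ y₂, W x₁ x₂ s (y₂, y₃) := by
  rw [prob_eq_sum (fun y₂ : Y₂ => (s, x₁, x₂, y₂, y₃))
    (fun y y' h => by simpa using h)
    (by
      rintro ⟨s', a, b, y, y'⟩
      simp only [Prod.mk.injEq, exists_and_left, exists_eq_left]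
      tauto)]
  simp only [joint, Finset.mul_sum]

theorem prob_joint_state (hP₁ : P₁ ∈ stdSimplex ℝ X₁) (hP₂ : ∀ x₁ s, P₂ x₁ s ∈ stdSimplex ℝ X₂)
    (hW : ∀ x₁ x₂ s, W x₁ x₂ s ∈ stdSimplex ℝ (Y₂ × Y₃)) (s : S) :
    prob (joint Q P₁ P₂ W) (fun z => z.1) s = Q s := by
  rw [← sum_prob_pair_left (joint Q P₁ P₂ W) (fun z => (z.2.1, z.2.2.1)) (fun z => z.1)]
  simp only [Fintype.sum_prod_type, prob_joint_input_state hW, ← Finset.mul_sum, (hP₂ _ s).2,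
    mul_one, hP₁.2]

/-- The conditional distribution of both outputs given the state and the relay input, times the
state distribution. -/
noncomputable def broadcastReference (Q : S → ℝ) (p : S × X₁ × X₂ × Y₂ × Y₃ → ℝ)
    (z : S × X₁ × X₂ × Y₂ × Y₃) : ℝ :=
  Q z.1 * normalize (fun y : Y₂ × Y₃ =>
    prob p (fun z => ((z.2.2.2.1, z.2.2.2.2), z.1, z.2.2.1)) (y, z.1, z.2.2.1)) z.2.2.2

/-- The distribution of `Y₃`, times that of `S` given `Y₃` and `X₁`, times that of `Y₂` given all
other variables. -/
noncomputable def multipleAccessReference (W : X₁ → X₂ → S → Y₂ × Y₃ → ℝ)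
    (p : S × X₁ × X₂ × Y₂ × Y₃ → ℝ) (z : S × X₁ × X₂ × Y₂ × Y₃) : ℝ :=
  prob p (fun z => z.2.2.2.2) z.2.2.2.2 *
    normalize (fun s => prob p (fun z => (z.2.1, z.1, z.2.2.2.2)) (z.2.1, s, z.2.2.2.2)) z.1 *
    normalize (fun y₂ => W z.2.1 z.2.2.1 z.1 (y₂, z.2.2.2.2)) z.2.2.2.1

theorem broadcastReference_nonneg (hQ : Q ∈ stdSimplex ℝ S) {p : S × X₁ × X₂ × Y₂ × Y₃ → ℝ}
    (hp : ∀ z, 0 ≤ p z) (z : S × X₁ × X₂ × Y₂ × Y₃) : 0 ≤ broadcastReference Q p z :=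
  mul_nonneg (hQ.1 _) (normalize_nonneg (fun _ => prob_nonneg hp _ _) _)

theorem multipleAccessReference_nonneg
    (hW : ∀ x₁ x₂ s, W x₁ x₂ s ∈ stdSimplex ℝ (Y₂ × Y₃)) {p : S × X₁ × X₂ × Y₂ × Y₃ → ℝ}
    (hp : ∀ z, 0 ≤ p z) (z : S × X₁ × X₂ × Y₂ × Y₃) : 0 ≤ multipleAccessReference W p z :=
  mul_nonneg (mul_nonneg (prob_nonneg hp _ _) (normalize_nonneg (fun _ => prob_nonneg hp _ _) _))
    (normalize_nonneg (fun _ => (hW _ _ _).1 _) _)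

theorem broadcastReference_eq {p : S × X₁ × X₂ × Y₂ × Y₃ → ℝ} (hp : ∀ z, 0 ≤ p z)
    {z : S × X₁ × X₂ × Y₂ × Y₃} (hz : 0 < p z) :
    broadcastReference Q p z = Q z.1 *
      (prob p (fun z => ((z.2.2.2.1, z.2.2.2.2), z.1, z.2.2.1)) (z.2.2.2, z.1, z.2.2.1) /
        prob p (fun z => (z.1, z.2.2.1)) (z.1, z.2.2.1)) := by
  rw [broadcastReference, normalize_eq_div (f := fun y : Y₂ × Y₃ =>
    prob p (fun z => ((z.2.2.2.1, z.2.2.2.2), z.1, z.2.2.1)) (y, z.1, z.2.2.1)) (fun _ => prob_nonneg hp _ _)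
    (prob_pos hp (fun z => ((z.2.2.2.1, z.2.2.2.2), z.1, z.2.2.1)) hz),
    sum_prob_pair_left p (fun z => (z.2.2.2.1, z.2.2.2.2)) (fun z => (z.1, z.2.2.1))]

theorem multipleAccessReference_eq
    (hW : ∀ x₁ x₂ s, W x₁ x₂ s ∈ stdSimplex ℝ (Y₂ × Y₃)) {p : S × X₁ × X₂ × Y₂ × Y₃ → ℝ}
    (hp : ∀ z, 0 ≤ p z) {z : S × X₁ × X₂ × Y₂ × Y₃} (hz : 0 < p z)
    (hWz : 0 < W z.2.1 z.2.2.1 z.1 z.2.2.2) :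
    multipleAccessReference W p z = prob p (fun z => z.2.2.2.2) z.2.2.2.2 *
      (prob p (fun z => (z.2.1, z.1, z.2.2.2.2)) (z.2.1, z.1, z.2.2.2.2) /
        prob p (fun z => (z.2.1, z.2.2.2.2)) (z.2.1, z.2.2.2.2)) *
      (W z.2.1 z.2.2.1 z.1 z.2.2.2 / ∑ y₂, W z.2.1 z.2.2.1 z.1 (y₂, z.2.2.2.2)) := by
  rw [multipleAccessReference, normalize_eq_div (f := fun s =>
    prob p (fun z => (z.2.1, z.1, z.2.2.2.2)) (z.2.1, s, z.2.2.2.2)) (fun _ => prob_nonneg hp _ _)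
    (prob_pos hp (fun z => (z.2.1, z.1, z.2.2.2.2)) hz),
    sum_prob_triple_middle p (fun z => z.2.1) (fun z => z.1) (fun z => z.2.2.2.2),
    normalize_eq_div (f := fun y₂ => W z.2.1 z.2.2.1 z.1 (y₂, z.2.2.2.2))
      (fun _ => (hW _ _ _).1 _) hWz]

theorem joint_factors_pos (hQ : Q ∈ stdSimplex ℝ S) (hP₁ : P₁ ∈ stdSimplex ℝ X₁)
    (hP₂ : ∀ x₁ s, P₂ x₁ s ∈ stdSimplex ℝ X₂) (hW : ∀ x₁ x₂ s, W x₁ x₂ s ∈ stdSimplex ℝ (Y₂ × Y₃))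
    {z : S × X₁ × X₂ × Y₂ × Y₃} (hz : 0 < joint Q P₁ P₂ W z) :
    0 < Q z.1 ∧ 0 < P₁ z.2.1 ∧ 0 < P₂ z.2.1 z.1 z.2.2.1 ∧ 0 < W z.2.1 z.2.2.1 z.1 z.2.2.2 := by
  have h : joint Q P₁ P₂ W z =
    Q z.1 * P₁ z.2.1 * P₂ z.2.1 z.1 z.2.2.1 * W z.2.1 z.2.2.1 z.1 z.2.2.2 := rfl
  rw [h] at hz
  have hne := hz.ne'
  simp only [mul_ne_zero_iff] at hne
  exact ⟨(hQ.1 _).lt_of_ne' hne.1.1.1, (hP₁.1 _).lt_of_ne' hne.1.1.2,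
    ((hP₂ _ _).1 _).lt_of_ne' hne.1.2, ((hW _ _ _).1 _).lt_of_ne' hne.2⟩

theorem broadcastReference_pos (hQ : Q ∈ stdSimplex ℝ S) (hP₁ : P₁ ∈ stdSimplex ℝ X₁)
    (hP₂ : ∀ x₁ s, P₂ x₁ s ∈ stdSimplex ℝ X₂) (hW : ∀ x₁ x₂ s, W x₁ x₂ s ∈ stdSimplex ℝ (Y₂ × Y₃))
    {z : S × X₁ × X₂ × Y₂ × Y₃} (hz : 0 < joint Q P₁ P₂ W z) :
    0 < broadcastReference Q (joint Q P₁ P₂ W) z := by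
  have hp := joint_nonneg hQ hP₁ hP₂ hW
  rw [broadcastReference_eq hp hz]
  exact mul_pos (joint_factors_pos hQ hP₁ hP₂ hW hz).1
    (div_pos (prob_pos hp (fun z => ((z.2.2.2.1, z.2.2.2.2), z.1, z.2.2.1)) hz)
      (prob_pos hp (fun z => (z.1, z.2.2.1)) hz))

theorem multipleAccessReference_pos (hQ : Q ∈ stdSimplex ℝ S) (hP₁ : P₁ ∈ stdSimplex ℝ X₁)
    (hP₂ : ∀ x₁ s, P₂ x₁ s ∈ stdSimplex ℝ X₂) (hW : ∀ x₁ x₂ s, W x₁ x₂ s ∈ stdSimplex ℝ (Y₂ × Y₃))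
    {z : S × X₁ × X₂ × Y₂ × Y₃} (hz : 0 < joint Q P₁ P₂ W z) :
    0 < multipleAccessReference W (joint Q P₁ P₂ W) z := by
  have hp := joint_nonneg hQ hP₁ hP₂ hW
  have hWz := (joint_factors_pos hQ hP₁ hP₂ hW hz).2.2.2
  rw [multipleAccessReference_eq hW hp hz hWz]
  exact mul_pos (mul_pos (prob_pos hp (fun z => z.2.2.2.2) hz)
    (div_pos (prob_pos hp (fun z => (z.2.1, z.1, z.2.2.2.2)) hz)
      (prob_pos hp (fun z => (z.2.1, z.2.2.2.2)) hz)))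
    (div_pos hWz (Finset.sum_pos' (fun _ _ => (hW _ _ _).1 _) ⟨z.2.2.2.1, Finset.mem_univ _, hWz⟩))

theorem condMutualInfo_broadcast (hQ : Q ∈ stdSimplex ℝ S) (hP₁ : P₁ ∈ stdSimplex ℝ X₁)
    (hP₂ : ∀ x₁ s, P₂ x₁ s ∈ stdSimplex ℝ X₂)
    (hW : ∀ x₁ x₂ s, W x₁ x₂ s ∈ stdSimplex ℝ (Y₂ × Y₃)) :
    condMutualInfo (joint Q P₁ P₂ W) (fun z => z.2.1) (fun z => (z.2.2.2.1, z.2.2.2.2))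
        (fun z => (z.1, z.2.2.1)) =
      ∑ z, joint Q P₁ P₂ W z * Real.logb 2 (Q z.1 * W z.2.1 z.2.2.1 z.1 z.2.2.2 /
        broadcastReference Q (joint Q P₁ P₂ W) z) := by
  have hp := joint_nonneg hQ hP₁ hP₂ hW
  rw [condMutualInfo_eq_sum]
  refine Finset.sum_congr rfl fun z _ => ?_
  rcases (hp z).eq_or_lt with h | h
  · simp [← h]
  · obtain ⟨h1, h2, h3, h4⟩ := joint_factors_pos hQ hP₁ hP₂ hW h
    have h5 := prob_pos hp (fun z => ((z.2.2.2.1, z.2.2.2.2), z.1, z.2.2.1)) h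
    have h6 := prob_pos hp (fun z => (z.1, z.2.2.1)) h
    rw [broadcastReference_eq hp h, prob_joint_letter, prob_joint_source_relay hW]
    congr 2
    simp only [Prod.mk.eta] at *
    field_simp

theorem condMutualInfo_multipleAccess (hQ : Q ∈ stdSimplex ℝ S) (hP₁ : P₁ ∈ stdSimplex ℝ X₁)
    (hP₂ : ∀ x₁ s, P₂ x₁ s ∈ stdSimplex ℝ X₂)
    (hW : ∀ x₁ x₂ s, W x₁ x₂ s ∈ stdSimplex ℝ (Y₂ × Y₃)) :
    condMutualInfo (joint Q P₁ P₂ W) (fun z => (z.2.1, z.2.2.1)) (fun z => z.2.2.2.2)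
        (fun z => z.1) -
      condMutualInfo (joint Q P₁ P₂ W) (fun z => z.2.1) (fun z => z.1) (fun z => z.2.2.2.2) =
      ∑ z, joint Q P₁ P₂ W z * Real.logb 2 (Q z.1 * W z.2.1 z.2.2.1 z.1 z.2.2.2 /
        multipleAccessReference W (joint Q P₁ P₂ W) z) := by
  have hp := joint_nonneg hQ hP₁ hP₂ hW
  rw [condMutualInfo_eq_sum, condMutualInfo_eq_sum, ← Finset.sum_sub_distrib]
  refine Finset.sum_congr rfl fun z _ => ?_
  rcases (hp z).eq_or_lt with h | h
  · simp [← h]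
  · obtain ⟨h1, h2, h3, h4⟩ := joint_factors_pos hQ hP₁ hP₂ hW h
    have h5 := prob_pos hp (fun z => z.2.2.2.2) h
    have h6 := prob_pos hp (fun z => (z.2.1, z.1, z.2.2.2.2)) h
    have h7 := prob_pos hp (fun z => (z.2.1, z.2.2.2.2)) h
    have h8 := prob_pos hp (fun z => (z.2.2.2.2, z.1)) h
    have h9 : prob (joint Q P₁ P₂ W) (fun z => (z.1, z.2.2.2.2)) (z.1, z.2.2.2.2) =
        prob (joint Q P₁ P₂ W) (fun z => (z.2.2.2.2, z.1)) (z.2.2.2.2, z.1) := by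
      exact prob_congr fun z => by simp only [Prod.mk.injEq, and_comm]
    have h10 : 0 < ∑ y₂, W z.2.1 z.2.2.1 z.1 (y₂, z.2.2.2.2) :=
      Finset.sum_pos' (fun _ _ => (hW _ _ _).1 _) ⟨z.2.2.2.1, Finset.mem_univ _, h4⟩
    rw [multipleAccessReference_eq hW hp h h4, prob_joint_input_output,
      prob_joint_input_state hW, prob_joint_state hP₁ hP₂ hW, h9, ← mul_sub,
      ← Real.logb_div (by positivity) (by positivity)]
    congr 2
    field_simp

end Joint

end SingleLetter

section Coding

variable {X₁ X₂ S Y₂ Y₃ : Type*} [Fintype S] [Fintype Y₂] [Fintype Y₃] {n M : ℕ}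

/-- The relay input at time `i`. -/
def Code.relayInput (c : Code X₁ X₂ S Y₂ Y₃ n M) (s : Fin n → S) (y₂ : Fin n → Y₂) (i : Fin n) :
    X₂ :=
  c.relay i s fun j => y₂ (Fin.castLE i.isLt.le j)

/-- The state, inputs and outputs at time `i`, as a function of message, states and outputs. -/
def Code.letter (c : Code X₁ X₂ S Y₂ Y₃ n M) (i : Fin n)
    (ω : Fin M × (Fin n → S) × (Fin n → Y₂) × (Fin n → Y₃)) : S × X₁ × X₂ × Y₂ × Y₃ :=
  (ω.2.1 i, c.enc ω.1 i, c.relayInput ω.2.1 ω.2.2.1 i, ω.2.2.1 i, ω.2.2.2 i)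

namespace RelayChannel

variable (ch : RelayChannel X₁ X₂ S Y₂ Y₃) (c : Code X₁ X₂ S Y₂ Y₃ n M)

/-- The joint law of message, states and outputs, for a uniformly distributed message. -/
noncomputable def blockLaw (ω : Fin M × (Fin n → S) × (Fin n → Y₂) × (Fin n → Y₃)) : ℝ :=
  ch.law c ω.1 ω.2.1 ω.2.2.1 ω.2.2.2 / M

/-- The law of the letter at a uniformly distributed time. -/
noncomputable def letterLaw (z : S × X₁ × X₂ × Y₂ × Y₃) : ℝ :=
  (∑ i, prob (ch.blockLaw c) (c.letter i) z) / n

theorem law_nonneg (m : Fin M) (s : Fin n → S) (y₂ : Fin n → Y₂) (y₃ : Fin n → Y₃) :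
    0 ≤ ch.law c m s y₂ y₃ :=
  Finset.prod_nonneg fun _ _ => mul_nonneg (ch.Q_mem.1 _) ((ch.W_mem _ _ _).1 _)

theorem blockLaw_nonneg (ω : Fin M × (Fin n → S) × (Fin n → Y₂) × (Fin n → Y₃)) :
    0 ≤ ch.blockLaw c ω :=
  div_nonneg (ch.law_nonneg c _ _ _ _) (Nat.cast_nonneg _)

theorem sum_law_mul (m : Fin M) (s : Fin n → S) (i : Fin n) (f : S × X₁ × X₂ × Y₂ × Y₃ → ℝ) :
    ∑ y₂, ∑ y₃, ch.law c m s y₂ y₃ * f (c.letter i (m, s, y₂, y₃)) =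
      ∑ y₂, ∑ y₃, ch.law c m s y₂ y₃ *
        ∑ y, ch.W (c.enc m i) (c.relayInput s y₂ i) (s i) y *
          f (s i, c.enc m i, c.relayInput s y₂ i, y) := by
  have h := sum_prod_causal_mul (Y := Y₂ × Y₃)
    (fun j h y => ch.W (c.enc m j) (c.relay j s fun k => (h k).1) (s j) y)
    (fun j h => (ch.W_mem _ _ _).2) i
    (fun h y => f (s i, c.enc m i, c.relay i s (fun k => (h k).1), y))
  rw [sum_arrow_prod (fun y₂ y₃ => ch.law c m s y₂ y₃ * f (c.letter i (m, s, y₂, y₃))),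
    sum_arrow_prod (fun y₂ y₃ => ch.law c m s y₂ y₃ *
        ∑ y, ch.W (c.enc m i) (c.relayInput s y₂ i) (s i) y *
          f (s i, c.enc m i, c.relayInput s y₂ i, y))]
  simp only [law, Finset.prod_mul_distrib, mul_assoc, ← Finset.mul_sum]
  exact congrArg _ h

theorem sum_law (m : Fin M) (s : Fin n → S) :
    ∑ y₂, ∑ y₃, ch.law c m s y₂ y₃ = ∏ i, ch.Q (s i) := by
  have h := sum_prod_causal (Y := Y₂ × Y₃)
    (fun j h y => ch.W (c.enc m j) (c.relay j s fun k => (h k).1) (s j) y)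
    (fun j h => (ch.W_mem _ _ _).2)
  rw [sum_arrow_prod (fun y₂ y₃ => ch.law c m s y₂ y₃)]
  simp only [law, Finset.prod_mul_distrib, ← Finset.mul_sum]
  exact (congrArg _ h).trans (mul_one _)

theorem sum_blockLaw_mul (f : Fin M × (Fin n → S) × (Fin n → Y₂) × (Fin n → Y₃) → ℝ) :
    ∑ ω, ch.blockLaw c ω * f ω =
      (∑ m, ∑ s, ∑ y₂, ∑ y₃, ch.law c m s y₂ y₃ * f (m, s, y₂, y₃)) / M := by
  simp only [blockLaw, Fintype.sum_prod_type, Finset.sum_div, div_mul_eq_mul_div]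

/-- State and source input at time `i` are independent, and the state has distribution `Q`. -/
theorem sum_blockLaw_mul_state_source (i : Fin n) (f : S → X₁ → ℝ) :
    ∑ ω, ch.blockLaw c ω * f (ω.2.1 i) (c.enc ω.1 i) =
      (∑ m, ∑ s, ch.Q s * f s (c.enc m i)) / M := by
  rw [ch.sum_blockLaw_mul c fun ω => f (ω.2.1 i) (c.enc ω.1 i)]
  congr 1
  refine Finset.sum_congr rfl fun m _ => ?_
  simp only [← Finset.sum_mul, ch.sum_law]
  have hQ : ∀ (j : Fin n) (_ : Fin j → S), ∑ s, ch.Q s = 1 := fun _ _ => ch.Q_mem.2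
  have h := sum_prod_causal_mul (fun _ _ s => ch.Q s) hQ i fun _ s => f s (c.enc m i)
  rw [h, ← Finset.sum_mul, sum_prod_causal _ hQ, one_mul]

theorem sum_blockLaw (hM : 0 < M) : ∑ ω, ch.blockLaw c ω = 1 := by
  have hQ : ∀ (j : Fin n) (_ : Fin j → S), ∑ s, ch.Q s = 1 := fun _ _ => ch.Q_mem.2
  have h := ch.sum_blockLaw_mul c fun _ => 1
  simp only [mul_one, ch.sum_law, sum_prod_causal (fun _ _ s => ch.Q s) hQ] at h
  rw [h]
  have : (M : ℝ) ≠ 0 := by positivity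
  simp [this]

theorem letterLaw_nonneg (z : S × X₁ × X₂ × Y₂ × Y₃) : 0 ≤ ch.letterLaw c z :=
  div_nonneg (Finset.sum_nonneg fun _ _ => prob_nonneg (ch.blockLaw_nonneg c) _ _)
    (Nat.cast_nonneg _)

theorem letterLaw_pos {ω : Fin M × (Fin n → S) × (Fin n → Y₂) × (Fin n → Y₃)}
    (h : 0 < ch.blockLaw c ω) (i : Fin n) : 0 < ch.letterLaw c (c.letter i ω) := by
  have hn : 0 < n := i.pos
  refine div_pos (Finset.sum_pos' (fun _ _ => prob_nonneg (ch.blockLaw_nonneg c) _ _)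
    ⟨i, Finset.mem_univ i, prob_pos (ch.blockLaw_nonneg c) (c.letter i) h⟩) (by positivity)

variable [Fintype X₁] [Fintype X₂]

theorem sum_letterLaw_mul (hn : 0 < n) (f : S × X₁ × X₂ × Y₂ × Y₃ → ℝ) :
    n * ∑ z, ch.letterLaw c z * f z = ∑ ω, ch.blockLaw c ω * ∑ i, f (c.letter i ω) := by
  have hn' : (n : ℝ) ≠ 0 := by positivity
  simp only [Finset.mul_sum]
  rw [Finset.sum_comm (s := (Finset.univ : Finset (Fin M × _)))]
  simp only [← sum_prob_mul (ch.blockLaw c) (c.letter _) f]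
  rw [Finset.sum_comm]
  refine Finset.sum_congr rfl fun z _ => ?_
  rw [← Finset.sum_mul, letterLaw]
  field_simp

/-- The law of a letter given state and inputs is that of the channel. -/
theorem sum_letterLaw_mul_channel (f : S × X₁ × X₂ × Y₂ × Y₃ → ℝ) (hn : 0 < n) :
    ∑ z, ch.letterLaw c z * f z = ∑ z, ch.letterLaw c z *
      ∑ y, ch.W z.2.1 z.2.2.1 z.1 y * f (z.1, z.2.1, z.2.2.1, y) := by
  have hn' : (n : ℝ) ≠ 0 := by positivity
  refine mul_left_cancel₀ hn' ?_
  rw [ch.sum_letterLaw_mul c hn, ch.sum_letterLaw_mul c hn]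
  simp only [Finset.mul_sum]
  rw [Finset.sum_comm, Finset.sum_comm (s := (Finset.univ : Finset (Fin M × _)))]
  refine Finset.sum_congr rfl fun i _ => ?_
  simp only [← Finset.mul_sum]
  rw [ch.sum_blockLaw_mul c fun ω => f (c.letter i ω), ch.sum_blockLaw_mul c fun ω =>
    ∑ y, ch.W (c.letter i ω).2.1 (c.letter i ω).2.2.1 (c.letter i ω).1 y *
      f ((c.letter i ω).1, (c.letter i ω).2.1, (c.letter i ω).2.2.1, y)]
  simp only [ch.sum_law_mul]
  rfl

/-- The law of a letter has the form of the joint distributions in the single-letter bounds. -/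
theorem exists_letterLaw_eq_joint [Nonempty X₂] (hn : 0 < n) (hM : 0 < M) :
    ∃ (P₁ : X₁ → ℝ) (P₂ : X₁ → S → X₂ → ℝ), P₁ ∈ stdSimplex ℝ X₁ ∧
      (∀ x₁ s, P₂ x₁ s ∈ stdSimplex ℝ X₂) ∧ ch.letterLaw c = joint ch.Q P₁ P₂ ch.W := by
  classical
  have hn' : (n : ℝ) ≠ 0 := by positivity
  have hM' : (M : ℝ) ≠ 0 := by positivity
  let N : X₁ → S → X₂ → ℝ := fun x₁ s x₂ =>
    prob (ch.letterLaw c) (fun z => (z.2.2.1, z.2.1, z.1)) (x₂, x₁, s)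
  have hN : ∀ x₁ s x₂, 0 ≤ N x₁ s x₂ := fun _ _ _ => prob_nonneg (ch.letterLaw_nonneg c) _ _
  let P₁ : X₁ → ℝ := fun x₁ => (∑ i, ∑ m, if c.enc m i = x₁ then 1 else 0) / (n * M)
  have hNsum : ∀ x₁ s, ∑ x₂, N x₁ s x₂ = ch.Q s * P₁ x₁ := fun x₁ s => by
    simp only [N, sum_prob_pair_left (ch.letterLaw c) (fun z => z.2.2.1) (fun z => (z.2.1, z.1))]
    have h1 : prob (ch.letterLaw c) (fun z => (z.2.1, z.1)) (x₁, s) =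
        ∑ z, ch.letterLaw c z * if z.2.1 = x₁ ∧ z.1 = s then 1 else 0 := by
      simp [prob]
    refine mul_left_cancel₀ hn' ?_
    rw [h1, ch.sum_letterLaw_mul c hn]
    simp only [Finset.mul_sum]
    rw [Finset.sum_comm]
    have h2 := fun i => ch.sum_blockLaw_mul_state_source c i
      fun s' x => if x = x₁ ∧ s' = s then 1 else 0
    refine (Finset.sum_congr rfl fun i _ => h2 i).trans ?_
    simp only [P₁]
    rw [← Finset.sum_div]
    field_simp
    rw [Finset.mul_sum]
    refine Finset.sum_congr rfl fun i _ => ?_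
    rw [Finset.mul_sum]
    refine Finset.sum_congr rfl fun m _ => ?_
    by_cases h : c.enc m i = x₁ <;> simp [h]
  refine ⟨P₁, fun x₁ s => normalize (N x₁ s), ⟨fun x₁ => ?_, ?_⟩, fun x₁ s =>
    ⟨fun x₂ => normalize_nonneg (hN x₁ s) x₂, sum_normalize _⟩, ?_⟩
  · exact div_nonneg (Finset.sum_nonneg fun _ _ => Finset.sum_nonneg fun _ _ => by
      split_ifs <;> norm_num) (by positivity)
  · simp only [P₁]
    rw [← Finset.sum_div, Finset.sum_comm]
    simp only [Finset.sum_comm (s := (Finset.univ : Finset X₁))]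
    simp [hn', hM']
  · funext ⟨s, x₁, x₂, y⟩
    have h1 : ch.letterLaw c (s, x₁, x₂, y) =
        ∑ z, ch.letterLaw c z * if z = (s, x₁, x₂, y) then 1 else 0 := by simp
    have h2 : joint ch.Q P₁ (fun x₁ s => normalize (N x₁ s)) ch.W (s, x₁, x₂, y) =
        N x₁ s x₂ * ch.W x₁ x₂ s y := by
      rw [← sum_mul_normalize (hN x₁ s) x₂, hNsum]
      rfl
    rw [h1, h2, ch.sum_letterLaw_mul_channel c _ hn]
    simp only [N, prob, Finset.sum_mul]
    refine Finset.sum_congr rfl fun z _ => ?_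
    obtain ⟨s', x₁', x₂', y'⟩ := z
    by_cases h : s' = s ∧ x₁' = x₁ ∧ x₂' = x₂
    · obtain ⟨rfl, rfl, rfl⟩ := h
      simp
    · have h3 : ∀ y'' : Y₂ × Y₃, ¬ (s', x₁', x₂', y'') = (s, x₁, x₂, y) := fun y'' e => by
        simp only [Prod.mk.injEq] at e
        tauto
      have h4 : ¬ (x₂', x₁', s') = (x₂, x₁, s) := fun e => by
        simp only [Prod.mk.injEq] at e
        tauto
      simp [h3, h4]

end RelayChannel

end Coding

section Converse

variable {X₁ X₂ S Y₂ Y₃ : Type*} {n M : ℕ}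

/-- A conditional distribution of the message given the output word: an equal mixture of the
decoded message and the uniform distribution. -/
noncomputable def Code.guess (c : Code X₁ X₂ S Y₂ Y₃ n M) (m : Fin M) (y₃ : Fin n → Y₃) : ℝ :=
  ((if c.dec y₃ = m then 1 else 0) + 1 / M) / 2

theorem Code.sum_guess (c : Code X₁ X₂ S Y₂ Y₃ n M) (hM : 0 < M) (y₃ : Fin n → Y₃) :
    ∑ m, c.guess m y₃ = 1 := by
  have hM' : (M : ℝ) ≠ 0 := by positivity
  simp only [guess]
  rw [← Finset.sum_div, Finset.sum_add_distrib]
  simp [hM']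

theorem Code.guess_pos (c : Code X₁ X₂ S Y₂ Y₃ n M) (hM : 0 < M) (m : Fin M) (y₃ : Fin n → Y₃) :
    0 < c.guess m y₃ := by
  have hM' : (0 : ℝ) < M := by positivity
  unfold guess
  split_ifs <;> positivity

theorem Code.logb_guess_le (c : Code X₁ X₂ S Y₂ Y₃ n M) (hM : 0 < M) (m : Fin M)
    (y₃ : Fin n → Y₃) :
    -Real.logb 2 (c.guess m y₃) ≤ 1 + (if c.dec y₃ = m then 0 else 1) * Real.logb 2 M := by
  have hM' : (0 : ℝ) < M := by positivity
  have h2 : Real.logb 2 (2⁻¹ : ℝ) = -1 := by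
    rw [Real.logb_inv, Real.logb_self_eq_one (by norm_num)]
  unfold guess
  split_ifs with h
  · have : Real.logb 2 (2⁻¹ : ℝ) ≤ Real.logb 2 ((1 + 1 / (M : ℝ)) / 2) := by
      refine Real.logb_le_logb_of_le (by norm_num) (by norm_num) ?_
      have : 0 < 1 / (M : ℝ) := by positivity
      linarith
    linarith
  · have : Real.logb 2 ((0 + 1 / (M : ℝ)) / 2) = -1 - Real.logb 2 M := by
      rw [zero_add, Real.logb_div (by positivity) (by norm_num), one_div, Real.logb_inv,
        Real.logb_self_eq_one (by norm_num)]
      ring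
    linarith

namespace RelayChannel

variable [Fintype S] [Fintype Y₂] [Fintype Y₃]

variable (ch : RelayChannel X₁ X₂ S Y₂ Y₃) (c : Code X₁ X₂ S Y₂ Y₃ n M)

theorem errorProb_eq_sum :
    ch.errorProb c = ∑ ω, ch.blockLaw c ω * if c.dec ω.2.2.2 = ω.1 then 0 else 1 := by
  rw [ch.sum_blockLaw_mul c fun ω => if c.dec ω.2.2.2 = ω.1 then 0 else 1]
  simp [errorProb]

theorem errorProb_le_one (hM : 0 < M) : ch.errorProb c ≤ 1 := by
  refine (ch.errorProb_eq_sum c).trans_le ((Finset.sum_le_sum fun ω _ => ?_).trans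
    (ch.sum_blockLaw c hM).le)
  have := ch.blockLaw_nonneg c ω
  split_ifs <;> simp [this]

theorem blockLaw_eq (ω : Fin M × (Fin n → S) × (Fin n → Y₂) × (Fin n → Y₃)) :
    ch.blockLaw c ω = (∏ i, ch.Q (c.letter i ω).1 *
      ch.W (c.letter i ω).2.1 (c.letter i ω).2.2.1 (c.letter i ω).1 (c.letter i ω).2.2.2) / M :=
  rfl

variable [Fintype X₁] [Fintype X₂]

theorem sum_letterLaw (hn : 0 < n) (hM : 0 < M) : ∑ z, ch.letterLaw c z = 1 := by
  have hn' : (n : ℝ) ≠ 0 := by positivity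
  have h := ch.sum_letterLaw_mul c hn fun _ => 1
  simp only [mul_one, Finset.sum_const, Finset.card_univ, Fintype.card_fin, nsmul_eq_mul] at h
  rw [← Finset.sum_mul, ch.sum_blockLaw c hM, one_mul] at h
  exact mul_left_cancel₀ hn' (h.trans (mul_one _).symm)

/-- A memoryless reference measure, together with Fano's inequality, bounds the number of
messages. -/
theorem one_sub_errorProb_mul_logb_le (hn : 0 < n) (hM : 0 < M)
    {G : S × X₁ × X₂ × Y₂ × Y₃ → ℝ} (hG : ∀ z, 0 ≤ G z)
    (hpos : ∀ z, 0 < ch.letterLaw c z → 0 < G z)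
    (hsum : ∑ ω : Fin M × (Fin n → S) × (Fin n → Y₂) × (Fin n → Y₃),
      c.guess ω.1 ω.2.2.2 * ∏ i, G (c.letter i ω) = 1) :
    (1 - ch.errorProb c) * Real.logb 2 M ≤
      n * ∑ z, ch.letterLaw c z * Real.logb 2 (ch.Q z.1 * ch.W z.2.1 z.2.2.1 z.1 z.2.2.2 / G z) +
        1 := by
  have hM' : (0 : ℝ) < M := by positivity
  have hgibbs := sum_mul_logb_div_nonneg (ch.blockLaw_nonneg c) (ch.sum_blockLaw c hM)
    (fun ω => mul_nonneg (c.guess_pos hM ω.1 ω.2.2.2).le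
      (Finset.prod_nonneg fun i _ => hG (c.letter i ω))) hsum.le
    (fun ω h => mul_pos (c.guess_pos hM ω.1 ω.2.2.2)
      (Finset.prod_pos fun i _ => hpos _ (ch.letterLaw_pos c h i)))
  let F : S × X₁ × X₂ × Y₂ × Y₃ → ℝ := fun z =>
    Real.logb 2 (ch.Q z.1 * ch.W z.2.1 z.2.2.1 z.1 z.2.2.2 / G z)
  have key : ∀ ω, ch.blockLaw c ω * Real.logb 2 (ch.blockLaw c ω /
      (c.guess ω.1 ω.2.2.2 * ∏ i, G (c.letter i ω))) ≤
      ch.blockLaw c ω * (∑ i, F (c.letter i ω)) +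
        (ch.blockLaw c ω * (1 - Real.logb 2 M) +
        (ch.blockLaw c ω * if c.dec ω.2.2.2 = ω.1 then 0 else 1) * Real.logb 2 M) := fun ω => by
    rcases (ch.blockLaw_nonneg c ω).eq_or_lt with h | h
    · simp [← h]
    · rw [mul_assoc, ← mul_add, ← mul_add]
      refine mul_le_mul_of_nonneg_left ?_ h.le
      have hprod : ∏ i, ch.Q (c.letter i ω).1 * ch.W (c.letter i ω).2.1 (c.letter i ω).2.2.1
          (c.letter i ω).1 (c.letter i ω).2.2.2 ≠ 0 := fun h0 => by
        rw [blockLaw_eq, h0, zero_div] at h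
        exact h.false
      have hGi : ∀ i, G (c.letter i ω) ≠ 0 := fun i => (hpos _ (ch.letterLaw_pos c h i)).ne'
      have hg := c.guess_pos hM ω.1 ω.2.2.2
      have hlog := c.logb_guess_le hM ω.1 ω.2.2.2
      have hF : ∑ i, F (c.letter i ω) =
          Real.logb 2 (∏ i, ch.Q (c.letter i ω).1 * ch.W (c.letter i ω).2.1 (c.letter i ω).2.2.1
            (c.letter i ω).1 (c.letter i ω).2.2.2) - Real.logb 2 (∏ i, G (c.letter i ω)) := by
        rw [← Real.logb_div hprod (Finset.prod_ne_zero_iff.2 fun i _ => hGi i),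
          ← Finset.prod_div_distrib, Real.logb_prod _ _ fun i hi =>
            div_ne_zero (Finset.prod_ne_zero_iff.1 hprod i hi) (hGi i)]
      rw [hF, Real.logb_div h.ne' (mul_ne_zero hg.ne'
        (Finset.prod_ne_zero_iff.2 fun i _ => hGi i)), Real.logb_mul hg.ne'
        (Finset.prod_ne_zero_iff.2 fun i _ => hGi i), blockLaw_eq, Real.logb_div hprod hM'.ne']
      linarith
  have hle := hgibbs.trans (Finset.sum_le_sum fun ω _ => key ω)
  rw [Finset.sum_add_distrib, Finset.sum_add_distrib, ← Finset.sum_mul, ← Finset.sum_mul,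
    ch.sum_blockLaw c hM, ← ch.errorProb_eq_sum c, ← ch.sum_letterLaw_mul c hn F] at hle
  linarith

theorem sum_broadcastReference [Nonempty (Y₂ × Y₃)] (hM : 0 < M)
    (p : S × X₁ × X₂ × Y₂ × Y₃ → ℝ) :
    ∑ ω : Fin M × (Fin n → S) × (Fin n → Y₂) × (Fin n → Y₃),
      c.guess ω.1 ω.2.2.2 * ∏ i, broadcastReference ch.Q p (c.letter i ω) = 1 := by
  let q : S → X₂ → Y₂ × Y₃ → ℝ := fun s x₂ => normalize fun y : Y₂ × Y₃ =>
    prob p (fun z => ((z.2.2.2.1, z.2.2.2.2), z.1, z.2.2.1)) (y, s, x₂)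
  have h : ∀ ω : Fin M × (Fin n → S) × (Fin n → Y₂) × (Fin n → Y₃),
      ∏ i, broadcastReference ch.Q p (c.letter i ω) = (∏ i, ch.Q (ω.2.1 i)) *
        ∏ i, q (ω.2.1 i) (c.relayInput ω.2.1 ω.2.2.1 i) (ω.2.2.1 i, ω.2.2.2 i) := fun ω => by
    rw [← Finset.prod_mul_distrib]
    rfl
  have hQ : ∀ (j : Fin n) (_ : Fin j → S), ∑ s, ch.Q s = 1 := fun _ _ => ch.Q_mem.2
  simp only [h]
  rw [Fintype.sum_prod_type, Finset.sum_comm]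
  simp only [← Finset.sum_mul, c.sum_guess hM, one_mul]
  rw [Fintype.sum_prod_type, ← sum_prod_causal (fun _ _ s => ch.Q s) hQ]
  refine Finset.sum_congr rfl fun s _ => ?_
  rw [Fintype.sum_prod_type, sum_arrow_prod (fun y₂ y₃ => (∏ i, ch.Q (s i)) *
        ∏ i, q (s i) (c.relayInput s y₂ i) (y₂ i, y₃ i)), ← Finset.mul_sum]
  have hq := sum_prod_causal (n := n) (Y := Y₂ × Y₃)
    (fun j h y => q (s j) (c.relay j s fun k => (h k).1) y) (fun j h => sum_normalize _)
  exact (congrArg _ hq).trans (mul_one _)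

theorem sum_multipleAccessReference [Nonempty S] [Nonempty Y₂] (hM : 0 < M)
    (p : S × X₁ × X₂ × Y₂ × Y₃ → ℝ) (hp : ∑ z, p z = 1) :
    ∑ ω : Fin M × (Fin n → S) × (Fin n → Y₂) × (Fin n → Y₃),
      c.guess ω.1 ω.2.2.2 * ∏ i, multipleAccessReference ch.W p (c.letter i ω) = 1 := by
  let q₃ : Y₃ → ℝ := prob p fun z => z.2.2.2.2
  let qS : Y₃ → X₁ → S → ℝ := fun y₃ x₁ => normalize fun s =>
    prob p (fun z => (z.2.1, z.1, z.2.2.2.2)) (x₁, s, y₃)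
  let q₂ : X₁ → X₂ → S → Y₃ → Y₂ → ℝ := fun x₁ x₂ s y₃ => normalize fun y₂ =>
    ch.W x₁ x₂ s (y₂, y₃)
  have h : ∀ ω : Fin M × (Fin n → S) × (Fin n → Y₂) × (Fin n → Y₃),
      ∏ i, multipleAccessReference ch.W p (c.letter i ω) = (∏ i, q₃ (ω.2.2.2 i)) *
        ((∏ i, qS (ω.2.2.2 i) (c.enc ω.1 i) (ω.2.1 i)) *
          ∏ i, q₂ (c.enc ω.1 i) (c.relayInput ω.2.1 ω.2.2.1 i) (ω.2.1 i) (ω.2.2.2 i)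
            (ω.2.2.1 i)) := fun ω => by
    rw [← Finset.prod_mul_distrib, ← Finset.prod_mul_distrib]
    exact Finset.prod_congr rfl fun i _ => mul_assoc _ _ _
  have h₂ : ∀ (m : Fin M) (s : Fin n → S) (y₃ : Fin n → Y₃), ∑ y₂ : Fin n → Y₂,
      ∏ i, q₂ (c.enc m i) (c.relayInput s y₂ i) (s i) (y₃ i) (y₂ i) = 1 := fun m s y₃ =>
    sum_prod_causal (fun j h y₂ => q₂ (c.enc m j) (c.relay j s h) (s j) (y₃ j) y₂)
      fun j h => sum_normalize _
  have hS : ∀ (m : Fin M) (y₃ : Fin n → Y₃), ∑ s : Fin n → S,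
      ∏ i, qS (y₃ i) (c.enc m i) (s i) = 1 := fun m y₃ =>
    sum_prod_causal (fun j _ s => qS (y₃ j) (c.enc m j) s) fun j h => sum_normalize _
  have h₃ : ∑ y₃ : Fin n → Y₃, ∏ i, q₃ (y₃ i) = 1 :=
    sum_prod_causal (fun _ _ y₃ => q₃ y₃) fun _ _ => (sum_prob p _).trans hp
  simp only [h]
  have hm : ∀ m : Fin M, ∑ t : (Fin n → S) × (Fin n → Y₂) × (Fin n → Y₃),
      c.guess m t.2.2 * ((∏ i, q₃ (t.2.2 i)) * ((∏ i, qS (t.2.2 i) (c.enc m i) (t.1 i)) *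
          ∏ i, q₂ (c.enc m i) (c.relayInput t.1 t.2.1 i) (t.1 i) (t.2.2 i) (t.2.1 i))) =
      ∑ y₃, c.guess m y₃ * ∏ i, q₃ (y₃ i) := fun m => by
    simp only [Fintype.sum_prod_type]
    have : ∀ s : Fin n → S, ∑ y₂ : Fin n → Y₂, ∑ y₃ : Fin n → Y₃,
        c.guess m y₃ * ((∏ i, q₃ (y₃ i)) * ((∏ i, qS (y₃ i) (c.enc m i) (s i)) *
          ∏ i, q₂ (c.enc m i) (c.relayInput s y₂ i) (s i) (y₃ i) (y₂ i))) =
        ∑ y₃ : Fin n → Y₃, c.guess m y₃ * ((∏ i, q₃ (y₃ i)) *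
          ∏ i, qS (y₃ i) (c.enc m i) (s i)) := fun s => by
      rw [Finset.sum_comm]
      simp only [← Finset.mul_sum, h₂, mul_one]
    simp only [this]
    rw [Finset.sum_comm]
    simp only [← Finset.mul_sum, hS, mul_one]
  rw [Fintype.sum_prod_type]
  simp only [hm]
  rw [Finset.sum_comm]
  simp only [← Finset.sum_mul, c.sum_guess hM, one_mul, h₃]

/-- The converse for a single code. -/
theorem exists_one_sub_errorProb_mul_logb_le [Nonempty X₁] [Nonempty X₂] (hn : 0 < n)
    (hM : 0 < M) : ∃ r ∈ generalValues ch,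
      (1 - ch.errorProb c) * Real.logb 2 M ≤ n * r + 1 := by
  obtain ⟨P₁, P₂, hP₁, hP₂, hP⟩ := ch.exists_letterLaw_eq_joint c hn hM
  have hS : Nonempty S := by
    by_contra h
    rw [not_nonempty_iff] at h
    simpa using ch.Q_mem.2
  have hY : Nonempty (Y₂ × Y₃) := by
    by_contra h
    rw [not_nonempty_iff] at h
    simpa only [Finset.univ_eq_empty, Finset.sum_empty, zero_ne_one] using
      (ch.W_mem (Classical.arbitrary X₁) (Classical.arbitrary X₂) (Classical.arbitrary S)).2
  have hY₂ : Nonempty Y₂ := hY.map Prod.fst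
  refine ⟨_, ⟨P₁, P₂, hP₁, hP₂, rfl⟩, ?_⟩
  have hp := ch.letterLaw_nonneg c
  have h1 := ch.one_sub_errorProb_mul_logb_le c hn hM
    (broadcastReference_nonneg ch.Q_mem hp)
    (fun z hz => by
      rw [hP] at hz ⊢
      exact broadcastReference_pos ch.Q_mem hP₁ hP₂ ch.W_mem hz)
    (ch.sum_broadcastReference c hM _)
  have h2 := ch.one_sub_errorProb_mul_logb_le c hn hM
    (multipleAccessReference_nonneg ch.W_mem hp)
    (fun z hz => by
      rw [hP] at hz ⊢
      exact multipleAccessReference_pos ch.Q_mem hP₁ hP₂ ch.W_mem hz)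
    (ch.sum_multipleAccessReference c hM _ (ch.sum_letterLaw c hn hM))
  rw [hP, ← condMutualInfo_broadcast ch.Q_mem hP₁ hP₂ ch.W_mem] at h1
  rw [hP, ← condMutualInfo_multipleAccess ch.Q_mem hP₁ hP₂ ch.W_mem] at h2
  rw [generalRate_eq, mul_min_of_nonneg _ _ (Nat.cast_nonneg n), ← min_add_add_right]
  exact le_min h1 h2

theorem capacity_le [Nonempty X₁] [Nonempty X₂] {r : ℝ} (hr : r ∈ upperBounds (generalValues ch)) :
    ch.capacity ≤ (r : EReal) := by
  refine sSup_le ?_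
  rintro _ ⟨R, ⟨hR, c, hc⟩, rfl⟩
  rw [EReal.coe_le_coe_iff]
  have hlim₁ : Tendsto (fun n => (1 - ch.errorProb (c n)) * R) atTop (𝓝 ((1 - 0) * R)) :=
    (tendsto_const_nhds.sub hc).mul_const R
  have hlim₂ : Tendsto (fun n : ℕ => r + 1 / (n : ℝ)) atTop (𝓝 (r + 0)) :=
    tendsto_const_nhds.add tendsto_one_div_atTop_nhds_zero_nat
  have hle := le_of_tendsto_of_tendsto hlim₁ hlim₂ ?_
  · simpa using hle
  · filter_upwards [eventually_gt_atTop 0] with n hn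
    have hn' : (0 : ℝ) < n := by exact_mod_cast hn
    have hpow : (0 : ℝ) < (2 : ℝ) ^ ((n : ℝ) * R) := by positivity
    have hM : 0 < ⌈(2 : ℝ) ^ ((n : ℝ) * R)⌉₊ := Nat.ceil_pos.2 hpow
    obtain ⟨t, ht, h⟩ := ch.exists_one_sub_errorProb_mul_logb_le (c n) hn hM
    have h1 : (n : ℝ) * R ≤ Real.logb 2 ⌈(2 : ℝ) ^ ((n : ℝ) * R)⌉₊ := by
      rw [Real.le_logb_iff_rpow_le (by norm_num) (by exact_mod_cast hM)]
      exact Nat.le_ceil _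
    have h2 := mul_le_mul_of_nonneg_left h1 (sub_nonneg.2 (ch.errorProb_le_one (c n) hM))
    have h3 := mul_le_mul_of_nonneg_left (hr ht) hn'.le
    refine le_of_mul_le_mul_left ?_ hn'
    have h4 : (n : ℝ) * (r + 1 / n) = n * r + 1 := by field_simp
    rw [h4]
    linarith

end RelayChannel

end Converse

section Maximum

theorem continuous_joint {X₁ X₂ S Y₂ Y₃ : Type*} (Q : S → ℝ)
    (W : X₁ → X₂ → S → Y₂ × Y₃ → ℝ) :
    Continuous fun P : (X₁ → ℝ) × (X₁ → S → X₂ → ℝ) => joint Q P.1 P.2 W := by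
  refine continuous_pi fun z => ?_
  obtain ⟨s, x₁, x₂, y₂, y₃⟩ := z
  simp only [joint]
  fun_prop

theorem RelayChannel.IsDegradedVia.joint_eq {X₁ X₂ S Y₂ Y₃ : Type*} [Fintype S] [Fintype Y₂]
    [Fintype Y₃] {ch : RelayChannel X₁ X₂ S Y₂ Y₃} {W₂ : X₁ → X₂ → S → Y₂ → ℝ}
    {W₃ : Y₂ → X₂ → S → Y₃ → ℝ} (hdeg : ch.IsDegradedVia W₂ W₃) (P₁ : X₁ → ℝ) (P₂ : X₁ → S → X₂ → ℝ) :
    joint ch.Q P₁ P₂ ch.W = jointDegraded ch.Q P₁ P₂ W₂ W₃ := by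
  funext ⟨s, x₁, x₂, y₂, y₃⟩
  simp only [joint, jointDegraded, hdeg.factor, mul_assoc]

variable {X₁ X₂ S Y₂ Y₃ : Type*} [Fintype X₁] [Fintype X₂] [Fintype S] [Fintype Y₂] [Fintype Y₃]

theorem continuousOn_generalRate :
    ContinuousOn (generalRate : (S × X₁ × X₂ × Y₂ × Y₃ → ℝ) → ℝ) {p | ∀ z, 0 ≤ p z} :=
  (continuousOn_condMutualInfo _ _ _).inf
    ((continuousOn_condMutualInfo _ _ _).sub (continuousOn_condMutualInfo _ _ _))

theorem exists_isGreatest_generalValues [Nonempty X₁] [Nonempty X₂]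
    (ch : RelayChannel X₁ X₂ S Y₂ Y₃) : ∃ r, IsGreatest (generalValues ch) r := by
  classical
  have hK : IsCompact (stdSimplex ℝ X₁ ×ˢ
      Set.pi Set.univ fun _ : X₁ => Set.pi Set.univ fun _ : S => stdSimplex ℝ X₂) :=
    (isCompact_stdSimplex ℝ X₁).prod
      (isCompact_univ_pi fun _ => isCompact_univ_pi fun _ => isCompact_stdSimplex ℝ X₂)
  have hcont : ContinuousOn (fun P : (X₁ → ℝ) × (X₁ → S → X₂ → ℝ) =>
      generalRate (joint ch.Q P.1 P.2 ch.W)) (stdSimplex ℝ X₁ ×ˢ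
      Set.pi Set.univ fun _ : X₁ => Set.pi Set.univ fun _ : S => stdSimplex ℝ X₂) :=
    continuousOn_generalRate.comp (continuous_joint ch.Q ch.W).continuousOn fun P hP =>
      joint_nonneg ch.Q_mem hP.1 (fun x₁ s => hP.2 x₁ trivial s trivial) ch.W_mem
  have hne : (stdSimplex ℝ X₁ ×ˢ
      Set.pi Set.univ fun _ : X₁ => Set.pi Set.univ fun _ : S => stdSimplex ℝ X₂).Nonempty :=
    Set.Nonempty.prod ⟨_, single_mem_stdSimplex ℝ (Classical.arbitrary X₁)⟩
      ⟨fun _ _ => _, fun _ _ _ _ => single_mem_stdSimplex ℝ (Classical.arbitrary X₂)⟩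
  obtain ⟨P, hP, hmax⟩ := hK.exists_isMaxOn hne hcont
  refine ⟨generalRate (joint ch.Q P.1 P.2 ch.W),
    ⟨P.1, P.2, hP.1, fun x₁ s => hP.2 x₁ trivial s trivial, rfl⟩, ?_⟩
  rintro _ ⟨P₁, P₂, hP₁, hP₂, rfl⟩
  exact isMaxOn_iff.1 hmax (P₁, P₂) ⟨hP₁, fun x₁ _ s _ => hP₂ x₁ s⟩

variable {ch : RelayChannel X₁ X₂ S Y₂ Y₃} {W₂ : X₁ → X₂ → S → Y₂ → ℝ} {W₃ : Y₂ → X₂ → S → Y₃ → ℝ}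

/-- For a physically degraded channel, `Y₃` gives no further information on `X₁`. -/
theorem RelayChannel.IsDegradedVia.condMutualInfo_eq (hdeg : ch.IsDegradedVia W₂ W₃)
    {P₁ : X₁ → ℝ} {P₂ : X₁ → S → X₂ → ℝ} (hP₁ : P₁ ∈ stdSimplex ℝ X₁)
    (hP₂ : ∀ x₁ s, P₂ x₁ s ∈ stdSimplex ℝ X₂) :
    condMutualInfo (joint ch.Q P₁ P₂ ch.W) (fun z => z.2.1)
        (fun z => (z.2.2.2.1, z.2.2.2.2)) (fun z => (z.1, z.2.2.1)) =
      condMutualInfo (joint ch.Q P₁ P₂ ch.W) (fun z => z.2.1) (fun z => z.2.2.2.1)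
        (fun z => (z.1, z.2.2.1)) := by
  have hp := joint_nonneg ch.Q_mem hP₁ hP₂ ch.W_mem
  set p := joint ch.Q P₁ P₂ ch.W with hpdef
  have hrelay : ∀ x₁ x₂ s y₂, prob p (fun z => (z.2.1, z.2.2.2.1, z.1, z.2.2.1)) (x₁, y₂, s, x₂) =
      ch.Q s * P₁ x₁ * P₂ x₁ s x₂ * W₂ x₁ x₂ s y₂ := fun x₁ x₂ s y₂ => by
    rw [prob_eq_sum (fun y₃ : Y₃ => (s, x₁, x₂, y₂, y₃))
      (fun y y' h => by simpa using h)
      (by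
        rintro ⟨s', a, b, y, y'⟩
        simp only [Prod.mk.injEq, exists_and_left, exists_eq]
        tauto)]
    simp only [hpdef, joint, hdeg.factor, ← Finset.mul_sum, (hdeg.right_mem _ _ _).2, mul_one]
  have hboth : ∀ x₁ x₂ s y₂ y₃,
      prob p (fun z => (z.2.1, (z.2.2.2.1, z.2.2.2.2), z.1, z.2.2.1)) (x₁, (y₂, y₃), s, x₂) =
        prob p (fun z => (z.2.1, z.2.2.2.1, z.1, z.2.2.1)) (x₁, y₂, s, x₂) * W₃ y₂ x₂ s y₃ :=
    fun x₁ x₂ s y₂ y₃ => by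
      rw [hrelay, hpdef, prob_joint_letter, hdeg.factor, ← mul_assoc]
  have hmarg : ∀ x₂ s y₂ y₃,
      prob p (fun z => ((z.2.2.2.1, z.2.2.2.2), z.1, z.2.2.1)) ((y₂, y₃), s, x₂) =
        prob p (fun z => (z.2.2.2.1, z.1, z.2.2.1)) (y₂, s, x₂) * W₃ y₂ x₂ s y₃ :=
    fun x₂ s y₂ y₃ => by
      rw [← sum_prob_pair_left p (fun z => z.2.1)
          (fun z => ((z.2.2.2.1, z.2.2.2.2), z.1, z.2.2.1)),
        ← sum_prob_pair_left p (fun z => z.2.1) (fun z => (z.2.2.2.1, z.1, z.2.2.1)),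
        Finset.sum_mul]
      exact Finset.sum_congr rfl fun x₁ _ => hboth x₁ x₂ s y₂ y₃
  rw [condMutualInfo_eq_sum, condMutualInfo_eq_sum]
  refine Finset.sum_congr rfl fun z _ => ?_
  rcases (hp z).eq_or_lt with h | h
  · simp [← h]
  · have hW₃ : W₃ z.2.2.2.1 z.2.2.1 z.1 z.2.2.2.2 ≠ 0 := fun h0 => by
      have h1 := prob_pos hp (fun z => ((z.2.2.2.1, z.2.2.2.2), z.1, z.2.2.1)) h
      rw [hmarg, h0, mul_zero] at h1
      exact h1.false
    rw [hboth, hmarg]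
    congr 2
    rw [mul_right_comm, ← mul_assoc, mul_div_mul_right _ _ hW₃]

theorem RelayChannel.IsDegradedVia.values_eq (hdeg : ch.IsDegradedVia W₂ W₃) :
    degradedValues ch.Q W₂ W₃ = generalValues ch := by
  ext r
  unfold degradedValues generalValues
  refine exists_congr fun P₁ => exists_congr fun P₂ => and_congr_right fun hP₁ =>
    and_congr_right fun hP₂ => ?_
  rw [← hdeg.joint_eq, generalRate_eq, degradedRate_eq, hdeg.condMutualInfo_eq hP₁ hP₂]

end Maximum

end RelayInfo

theorem corollary1 {X₁ X₂ S Y₂ Y₃ : Type*} [Fintype X₁] [Fintype X₂] [Fintype S] [Fintype Y₂]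
    [Fintype Y₃] [Nonempty X₁] [Nonempty X₂]
    (ch : RelayInfo.RelayChannel X₁ X₂ S Y₂ Y₃)
    (W₂ : X₁ → X₂ → S → Y₂ → ℝ) (W₃ : Y₂ → X₂ → S → Y₃ → ℝ) (hdeg : ch.IsDegradedVia W₂ W₃) :
    ∃ RD : ℝ, IsGreatest (RelayInfo.degradedValues ch.Q W₂ W₃) RD ∧
      IsGreatest (RelayInfo.generalValues ch) RD ∧
      ch.capacity ≤ (RD : EReal) := by
  obtain ⟨r, hr⟩ := RelayInfo.exists_isGreatest_generalValues ch
  exact ⟨r, hdeg.values_eq ▸ hr, hr, ch.capacity_le hr.2⟩
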